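/- Let $N\ge 2$. Let $A:(0,\infty)\to(0,\infty)$ be continuous and such that $t\mapsto tA(|t|)$ (with value $0$ at $t=0$) is continuous on $\mathbb{R}$ and continuously differentiable on $(0,\infty)$, with $(tA(t))'>0$ for all $t>0$ and $\lim_{t\to+\infty}tA(t)=+\infty$. Put $$G(t)=t^2A(t)-\int_0^t sA(s)\,ds,\qquad t\ge 0,$$ with $G(0)=0$; this is a strictly increasing bijection of $[0,\infty)$ onto itself. Let $H$ be its inverse. Let $f:\mathbb{R}\to\mathbb{R}$ be a continuous function such that $f(t)>0$ for $t<0$, $f$ is non-increasing on $(-\infty,0)$, and $$\int_{-\infty}^{-1}\frac{1}{H\left(\int_t^{-1}f(s)\,ds\right)}\,dt<+\infty .$$ Let $u$ be a solution of $$-\operatorname{div}\bigl(A(|\nabla u|)\nabla u\bigr)\ge f(u)\quad\text{on }\mathbb{R}^N,$$ that is, $u\in C^1(\mathbb{R}^N)$ and $$\int_{\mathbb{R}^N}A(|\nabla u|)\,\nabla u\cdot\nabla\phi\,dx\ \ge\ \int_{\mathbb{R}^N}f(u)\,\phi\,dx$$ for every nonnegative $\phi\in C^1(\mathbb{R}^N)$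 with compact support, where $A(|\nabla u|)\nabla u$ is understood as $0$ wherever $\nabla u=0$. Then $u\ge 0$ on $\mathbb{R}^N$. -/

import Mathlib

open MeasureTheory Set Filter

/-- Structural conditions on the coefficient `A` of the operator `-div (A(|∇u|) ∇u)`.
Only the values of `A` on `(0, ∞)` matter: the product `t * A |t|` vanishes at `t = 0` whatever
the value `A 0`, so its continuity at the origin says that `t * A t → 0` as `t → 0+`. -/
structure IsQuasilinearCoeff (A : ℝ → ℝ) : Prop where
  continuousOn : ContinuousOn A (Ioi 0)
  pos : ∀ t : ℝ, 0 < t → 0 < A t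
  continuous_flux : Continuous fun t : ℝ => t * A |t|
  contDiffOn_flux : ContDiffOn ℝ 1 (fun t : ℝ => t * A |t|) (Ioi 0)
  deriv_flux_pos : ∀ t : ℝ, 0 < t → 0 < deriv (fun s : ℝ => s * A s) t

/-- `G(t) = t² A(t) - ∫₀ᵗ s A(s) ds`, used for `t ≥ 0`. -/
noncomputable def energyG (A : ℝ → ℝ) (t : ℝ) : ℝ :=
  t ^ 2 * A t - ∫ s in (0 : ℝ)..t, s * A s

/-- The inverse `H` of `G : [0, ∞) → [0, ∞)`, used for nonnegative arguments. -/
noncomputable def energyH (A : ℝ → ℝ) : ℝ → ℝ :=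
  Function.invFunOn (energyG A) (Ici 0)

/-- `u` is a weak `C¹` solution of `-div (A(|∇u|) ∇u) ≥ h` on the whole of `ℝᴺ`. The test
functions are the nonnegative compactly supported `C¹` functions. -/
structure IsWeakSupersolution {N : ℕ} (A : ℝ → ℝ) (h : EuclideanSpace ℝ (Fin N) → ℝ)
    (u : EuclideanSpace ℝ (Fin N) → ℝ) : Prop where
  contDiff : ContDiff ℝ 1 u
  weak_ineq : ∀ φ : EuclideanSpace ℝ (Fin N) → ℝ, ContDiff ℝ 1 φ → HasCompactSupport φ →
    (∀ x, 0 ≤ φ x) →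
    ∫ x, h x * φ x ≤ ∫ x, inner ℝ (A ‖gradient u x‖ • gradient u x) (gradient φ x)

/-! Suppose `u` is negative somewhere, say at the origin, and put `v = -u`. The idea is to trap `v`
under a radial barrier that starts below `v 0` and is very large on a sphere of controlled radius.
The barrier `W(|x|)` has flux `b(r)x/r` with `b' = q(W)` and `N q(s) = f(-s)`. As `b'` is
nondecreasing, `b ≤ r b'`, so the divergence `b' + (N-1)b/r` is at most `N b' = f(-W)`, which makes
`W` a supersolution of the inequality satisfied by `v` (`integral_inner_radial_gradient_ge`). The
one-dimensional system has the first integral `G(W') = ∫_α^W q`, where `α = W(0)`. The integrability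
hypothesis then bounds the radius needed to reach any height
(`exists_radius_forall_exists_profile`). This radius `R` does not depend on the height, so the
height may be chosen afterwards as a bound for `v` on the ball of radius `R + 1`. Hence `v ≤ W` for
`R ≤ |x| ≤ R + 1`. Testing with a cut-off of `(v - W)₊²`, strict monotonicity of the vector flux
(`inner_vectorFlux_sub_pos`) and monotonicity of `f` make the test function constant. It is positive
at `0` and vanishes at distance `R + 1`, a contradiction. -/

/-! ### Quadrature for the one-dimensional profile -/

theorem exists_inverse_primitive {p : ℝ → ℝ} (hp : Continuous p) {c : ℝ} (hc : 0 < c)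
    (hcp : ∀ x, c ≤ p x) (x₀ : ℝ) :
    ∃ Q : ℝ → ℝ, (∀ y, ∫ x in x₀..Q y, p x = y) ∧ (∀ y, HasDerivAt Q (p (Q y))⁻¹ y) ∧
      Q 0 = x₀ := by
  set P : ℝ → ℝ := fun x => ∫ s in x₀..x, p s with hP
  have hder : ∀ x, HasDerivAt P (p x) x := fun x => hp.integral_hasStrictDerivAt x₀ x |>.hasDerivAt
  have hmono : StrictMono P := by
    refine strictMono_of_deriv_pos fun x => ?_
    rw [(hder x).deriv]
    exact hc.trans_le (hcp x)
  have hcont : Continuous P := continuous_iff_continuousAt.2 fun x => (hder x).continuousAt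
  -- The slope bound `c` forces linear growth at both ends, hence surjectivity.
  have hlin : Monotone fun x => P x - c * x := by
    refine monotone_of_deriv_nonneg (fun x => ?_) fun x => ?_
    · exact ((hder x).sub ((hasDerivAt_id x).const_mul c)).differentiableAt
    · have h : HasDerivAt (fun x => P x - c * x) (p x - c * 1) x :=
        (hder x).sub ((hasDerivAt_id x).const_mul c)
      rw [h.deriv]
      simpa using hcp x
  have hx₀ : P x₀ = 0 := by simp [hP]
  have hsurj : Function.Surjective P := by
    refine hcont.surjective ?_ ?_
    · refine tendsto_atTop_mono' _ (f₁ := fun x => c * (x - x₀)) ?_ ?_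
      · filter_upwards [eventually_ge_atTop x₀] with x hx
        have := hlin hx
        simp only [hx₀] at this
        linarith
      · exact (tendsto_atTop_add_const_right _ (-x₀) tendsto_id).const_mul_atTop hc
    · refine tendsto_atBot_mono' atBot (f₁ := fun x => c * (x - x₀)) ?_ ?_
      · filter_upwards [eventually_le_atBot x₀] with x hx
        have := hlin hx
        simp only [hx₀] at this
        linarith
      · exact (tendsto_atBot_add_const_right _ (-x₀) tendsto_id).const_mul_atBot hc
  let E := hmono.orderIsoOfSurjective P hsurj
  have hE : ∀ y, P (E.symm y) = y := fun y => E.apply_symm_apply y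
  refine ⟨E.symm, hE, fun y => ?_, ?_⟩
  · exact (hder _).of_local_left_inverse E.symm.continuous.continuousAt
      (hc.trans_le (hcp _)).ne' (Eventually.of_forall hE)
  · exact hmono.injective ((hE 0).trans hx₀.symm)

/-- The one-dimensional equation `(ψ⁻¹ (W'))' = q (W)`, `W 0 = α`, `W' 0 = ψ 0`, solved by
quadrature together with its first integral. -/
theorem exists_profile {ψ q : ℝ → ℝ} (hψ : Continuous ψ) (hq : Continuous q) {c S : ℝ}
    (hc : 0 < c) (hcq : ∀ s, c ≤ q s) (hqS : ∀ s, q s ≤ S) (α : ℝ) :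
    ∃ W b : ℝ → ℝ, W 0 = α ∧ b 0 = 0 ∧ (∀ r, HasDerivAt b (q (W r)) r) ∧
      (∀ r, HasDerivAt W (ψ (b r)) r) ∧
      ∀ r, ∫ s in α..W r, q s = ∫ s in (0 : ℝ)..b r, ψ s := by
  obtain ⟨Q, hQ, hQ', hQ0⟩ := exists_inverse_primitive hq hc hcq α
  -- The flux `β` serves as independent variable: dividing `W' = ψ(b)` by `b' = q(W)` separates into
  -- `q(w) dw = ψ(β) dβ`.
  set w : ℝ → ℝ := fun β => Q (∫ s in (0 : ℝ)..β, ψ s) with hw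
  have hqpos : ∀ s, 0 < q s := fun s => hc.trans_le (hcq s)
  have hw' : ∀ β, HasDerivAt w ((q (w β))⁻¹ * ψ β) β := fun β =>
    (hQ' _).comp β (hψ.integral_hasStrictDerivAt 0 β).hasDerivAt
  have hwc : Continuous w := continuous_iff_continuousAt.2 fun x => (hw' x).continuousAt
  have hS : 0 < S := (hqpos 0).trans_le (hqS 0)
  -- The radius as a function of the flux is `∫ dβ / q(w(β))`, and `b` is its inverse. The bound `q
  -- ≤ S` makes `b` defined for every radius; no Lipschitz condition enters.
  obtain ⟨b, hb, hb', hb0⟩ := exists_inverse_primitive (p := fun β => (q (w β))⁻¹)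
    ((hq.comp hwc).inv₀ fun x => (hqpos _).ne') (inv_pos.2 hS)
    (fun x => inv_anti₀ (hqpos _) (hqS _)) 0
  simp only [inv_inv] at hb'
  refine ⟨fun r => w (b r), b, ?_, hb0, hb', fun r => ?_, fun r => hQ _⟩
  · simp [hw, hb0, hQ0]
  · have := (hw' (b r)).comp r (hb' r)
    refine this.congr_deriv ?_
    have := (hqpos (w (b r))).ne'
    field_simp

/-! ### The scalar flux, `G` and `H` -/

namespace IsQuasilinearCoeff

variable {A : ℝ → ℝ}

theorem hasDerivAt_flux (hA : IsQuasilinearCoeff A) {t : ℝ} (ht : 0 < t) :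
    ∃ d, 0 < d ∧ HasDerivAt (fun t : ℝ => t * A |t|) d t := by
  have h1 : DifferentiableAt ℝ (fun t : ℝ => t * A |t|) t :=
    (hA.contDiffOn_flux.differentiableOn one_ne_zero).differentiableAt (Ioi_mem_nhds ht)
  refine ⟨_, ?_, h1.hasDerivAt⟩
  have h2 : (fun t : ℝ => t * A |t|) =ᶠ[nhds t] fun s => s * A s := by
    filter_upwards [Ioi_mem_nhds ht] with s hs
    rw [abs_of_pos hs]
  rw [h2.deriv_eq]
  exact hA.deriv_flux_pos t ht

theorem strictMono_flux (hA : IsQuasilinearCoeff A) : StrictMono fun t : ℝ => t * A |t| := by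
  have h : StrictMonoOn (fun t : ℝ => t * A |t|) (Ici 0) := by
    refine strictMonoOn_of_deriv_pos (convex_Ici 0) hA.continuous_flux.continuousOn ?_
    intro t ht
    rw [interior_Ici] at ht
    obtain ⟨d, hd, hd'⟩ := hA.hasDerivAt_flux ht
    rwa [hd'.deriv]
  exact strictMono_of_odd_strictMonoOn_nonneg (fun x => by simp) h

/-- The flux `t ↦ t * A |t|` as an increasing bijection of `ℝ`. -/
noncomputable def fluxIso (hA : IsQuasilinearCoeff A)
    (hA_top : Tendsto (fun t : ℝ => t * A t) atTop atTop) : ℝ ≃o ℝ :=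
  hA.strictMono_flux.orderIsoOfSurjective (fun t : ℝ => t * A |t|) <| by
    have htop : Tendsto (fun t : ℝ => t * A |t|) atTop atTop := by
      refine hA_top.congr' ?_
      filter_upwards [eventually_ge_atTop 0] with t ht
      rw [abs_of_nonneg ht]
    refine hA.continuous_flux.surjective htop ?_
    have := tendsto_neg_atTop_atBot.comp (htop.comp tendsto_neg_atBot_atTop)
    refine this.congr fun x => ?_
    simp

variable (hA : IsQuasilinearCoeff A) (hA_top : Tendsto (fun t : ℝ => t * A t) atTop atTop)

theorem fluxIso_apply (t : ℝ) : hA.fluxIso hA_top t = t * A |t| := rfl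

theorem fluxIso_zero : hA.fluxIso hA_top 0 = 0 := by simp [fluxIso_apply]

theorem fluxIso_symm_zero : (hA.fluxIso hA_top).symm 0 = 0 := by
  rw [OrderIso.symm_apply_eq, fluxIso_zero]

/-- Young's equality: `energyG A` is the primitive of the inverse flux, evaluated at the flux. -/
theorem energyG_eq {t : ℝ} (ht : 0 ≤ t) :
    energyG A t = ∫ s in (0 : ℝ)..hA.fluxIso hA_top t, (hA.fluxIso hA_top).symm s := by
  set e := hA.fluxIso hA_top with he
  set a : ℝ → ℝ := fun t => t * A |t| with ha
  have hac : Continuous a := hA.continuous_flux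
  set D : ℝ → ℝ := fun t => t * a t - (∫ s in (0 : ℝ)..t, a s) - ∫ s in (0 : ℝ)..a t, e.symm s
  have hK : ∀ x, HasDerivAt (fun x => ∫ s in (0 : ℝ)..x, e.symm s) (e.symm x) x := fun x =>
    (e.symm.continuous.integral_hasStrictDerivAt 0 x).hasDerivAt
  have hI : ∀ x, HasDerivAt (fun x => ∫ s in (0 : ℝ)..x, a s) (a x) x := fun x =>
    (hac.integral_hasStrictDerivAt 0 x).hasDerivAt
  -- The derivative of `D` cancels for positive argument. The flux need not be differentiable at
  -- `0`, so the mean value theorem is used with mere continuity there.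
  have hD : D t = D 0 := by
    rcases ht.eq_or_lt with rfl | ht
    · rfl
    have hcont : Continuous D := by
      have h1 : Continuous fun x => ∫ s in (0 : ℝ)..x, e.symm s :=
        continuous_iff_continuousAt.2 fun x => (hK x).continuousAt
      have h2 : Continuous fun x => ∫ s in (0 : ℝ)..x, a s :=
        continuous_iff_continuousAt.2 fun x => (hI x).continuousAt
      exact ((continuous_id.mul hac).sub h2).sub (h1.comp hac)
    obtain ⟨x, -, hx⟩ := exists_hasDerivAt_eq_slope D (fun _ => 0) ht hcont.continuousOn
      fun x hx => by
        obtain ⟨d, -, hd⟩ := hA.hasDerivAt_flux hx.1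
        refine ((((hasDerivAt_id x).mul hd).sub (hI x)).sub ((hK (a x)).comp x hd)).congr_deriv ?_
        have : e.symm (a x) = x := e.symm_apply_apply x
        simp only [this, id]
        ring
    rw [eq_div_iff (by linarith)] at hx
    linarith
  have hD0 : D 0 = 0 := by simp [D, ha]
  have hs : ∫ s in (0 : ℝ)..t, s * A s = ∫ s in (0 : ℝ)..t, a s := by
    refine intervalIntegral.integral_congr fun s hs => ?_
    rw [uIcc_of_le ht] at hs
    simp [ha, abs_of_nonneg hs.1]
  have ht' : t * a t = t ^ 2 * A t := by
    simp only [ha, abs_of_nonneg ht]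
    ring
  rw [hD0] at hD
  simp only [D, ht'] at hD
  rw [energyG, hs]
  exact sub_eq_zero.1 hD

/-- `energyG A` extends to an increasing bijection of the line whose inverse extends
`energyH A`. -/
theorem exists_energyIso (hA : IsQuasilinearCoeff A)
    (hA_top : Tendsto (fun t : ℝ => t * A t) atTop atTop) :
    ∃ E : ℝ ≃o ℝ, E 0 = 0 ∧ (∀ t, 0 ≤ t → energyG A t = E t) ∧
    ∀ y, 0 ≤ y → energyH A y = E.symm y := by
  set e := hA.fluxIso hA_top with he
  have he0 : e 0 = 0 := hA.fluxIso_zero hA_top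
  have hes0 : e.symm 0 = 0 := hA.fluxIso_symm_zero hA_top
  have hodd : ∀ b, e.symm (-b) = -e.symm b := fun b => by
    rw [OrderIso.symm_apply_eq, he, fluxIso_apply, abs_neg, neg_mul, ← fluxIso_apply hA hA_top,
      OrderIso.apply_symm_apply]
  have hpos : ∀ b, 0 < b → 0 < e.symm b := fun b hb => by
    rw [← hes0]
    exact e.symm.strictMono hb
  have hc : Continuous fun s => |e.symm s| := e.symm.continuous.abs
  -- The absolute value makes the primitive odd and increasing on the whole line without changing it
  -- on `[0, ∞)`.
  set V : ℝ → ℝ := fun b => ∫ s in (0 : ℝ)..b, |e.symm s| with hV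
  have hder : ∀ b, HasDerivAt V |e.symm b| b := fun b =>
    (hc.integral_hasStrictDerivAt 0 b).hasDerivAt
  have hVc : Continuous V := continuous_iff_continuousAt.2 fun b => (hder b).continuousAt
  have hVodd : ∀ b, V (-b) = -V b := fun b => by
    have h := intervalIntegral.integral_comp_neg (a := 0) (b := b) (fun s => |e.symm s|)
    simp only [hodd, abs_neg, neg_zero] at h
    simp only [hV]
    rw [h, intervalIntegral.integral_symm]
  have hVmono : StrictMono V := by
    refine strictMono_of_odd_strictMonoOn_nonneg hVodd ?_
    refine strictMonoOn_of_deriv_pos (convex_Ici 0) hVc.continuousOn fun b hb => ?_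
    rw [interior_Ici] at hb
    rw [(hder b).deriv]
    exact abs_pos.2 (hpos b hb).ne'
  have hV0 : V 0 = 0 := by simp [hV]
  have htop : Tendsto V atTop atTop := by
    have hm : MonotoneOn (fun b => V b - e.symm 1 * b) (Ici 1) := by
      have h : ∀ b, HasDerivAt (fun b => V b - e.symm 1 * b) (|e.symm b| - e.symm 1 * 1) b :=
        fun b => (hder b).sub ((hasDerivAt_id b).const_mul _)
      refine monotoneOn_of_deriv_nonneg (convex_Ici 1)
        (fun b _ => (h b).continuousAt.continuousWithinAt)
        (fun b _ => (h b).differentiableAt.differentiableWithinAt) fun b hb => ?_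
      rw [interior_Ici] at hb
      rw [(h b).deriv, mul_one, sub_nonneg]
      exact (e.symm.monotone (le_of_lt hb)).trans (le_abs_self _)
    refine tendsto_atTop_mono' _ (f₁ := fun b => e.symm 1 * (b - 1)) ?_
      ((tendsto_atTop_add_const_right _ (-1) tendsto_id).const_mul_atTop (hpos 1 one_pos))
    filter_upwards [eventually_ge_atTop 1] with b hb
    have h1 := hm (mem_Ici.2 le_rfl) hb hb
    have h2 : 0 < V 1 := hV0 ▸ hVmono one_pos
    simp only at h1
    linarith
  have hsurj : Function.Surjective V := by
    refine hVc.surjective htop ?_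
    refine (tendsto_neg_atTop_atBot.comp (htop.comp tendsto_neg_atBot_atTop)).congr fun x => ?_
    simp [hVodd]
  let E : ℝ ≃o ℝ := e.trans (hVmono.orderIsoOfSurjective V hsurj)
  have hE : ∀ t, E t = V (e t) := fun t => rfl
  have hE0 : E 0 = 0 := by rw [hE, he0, hV0]
  have hG : ∀ t, 0 ≤ t → energyG A t = E t := fun t ht => by
    rw [hA.energyG_eq hA_top ht, hE]
    refine intervalIntegral.integral_congr fun s hs => ?_
    have h0 : 0 ≤ e t := by
      rw [← he0]
      exact e.monotone ht
    rw [uIcc_of_le h0] at hs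
    have : 0 ≤ e.symm s := by
      rw [← hes0]
      exact e.symm.monotone hs.1
    exact (abs_of_nonneg this).symm
  refine ⟨E, hE0, hG, fun y hy => ?_⟩
  have hy' : 0 ≤ E.symm y := by
    rw [E.le_symm_apply, hE0]
    exact hy
  have hinj : InjOn (energyG A) (Ici 0) := fun s hs t ht hst => by
    rw [hG s hs, hG t ht] at hst
    exact E.injective hst
  have := hinj.leftInvOn_invFunOn hy'
  rwa [hG _ hy', E.apply_symm_apply] at this

end IsQuasilinearCoeff

/-! ### The Keller-Osserman estimate -/

/-- Convexity of the primitive of a positive nonincreasing `f`: shrinking the interval of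
integration by the factor `n` costs at least the factor `n`. -/
theorem integral_le_integral_div_of_antitoneOn {f : ℝ → ℝ} (hf : Continuous f)
    (hf_anti : AntitoneOn f (Iio 0)) {n : ℝ} (hn : 1 ≤ n) {w : ℝ} (hw : 1 ≤ w) :
    ∫ s in (-1 - (w - 1) / n)..(-1 : ℝ), f s ≤ ∫ s in (1 : ℝ)..w, f (-s) / n := by
  have hn0 : 0 < n := one_pos.trans_le hn
  have hk : ∀ x ∈ uIcc 1 w, HasDerivAt (fun σ : ℝ => -1 - (σ - 1) / n) (-(1 / n)) x := fun x _ =>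
    (((hasDerivAt_id x).sub_const 1).div_const n).const_sub (-1)
  have h := intervalIntegral.integral_comp_mul_deriv hk continuousOn_const hf
  simp only [sub_self, zero_div, sub_zero] at h
  rw [intervalIntegral.integral_symm, ← h, ← intervalIntegral.integral_neg]
  refine intervalIntegral.integral_mono_on hw ?_ ?_ fun s hs => ?_
  · exact Continuous.intervalIntegrable (by simp only [Function.comp_def]; fun_prop) _ _
  · exact Continuous.intervalIntegrable (by fun_prop) _ _
  · have h1 : (s - 1) / n ≤ s - 1 := div_le_self (by linarith [hs.1]) hn
    have h0 : 0 ≤ (s - 1) / n := div_nonneg (by linarith [hs.1]) hn0.le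
    have h2 : f (-1 - (s - 1) / n) ≤ f (-s) :=
      hf_anti (mem_Iio.2 (by linarith [hs.1])) (mem_Iio.2 (by linarith)) (by linarith)
    simp only [Function.comp_apply, mul_neg, neg_neg, mul_one_div]
    gcongr

/-- The Keller-Osserman condition: radial profiles starting at height `α` exceed any given
height before a fixed radius. -/
theorem exists_radius_forall_exists_profile {A : ℝ → ℝ} (hA : IsQuasilinearCoeff A)
    (hA_top : Tendsto (fun t : ℝ => t * A t) atTop atTop) {f : ℝ → ℝ} (hf : Continuous f)
    (hf_pos : ∀ t : ℝ, t < 0 → 0 < f t) (hf_anti : AntitoneOn f (Iio 0))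
    (hf_int : IntegrableOn (fun t : ℝ => 1 / energyH A (∫ s in t..(-1 : ℝ), f s)) (Iio (-1)))
    {n : ℝ} (hn : 1 ≤ n) {α : ℝ} (hα : 0 < α) (hα1 : α ≤ 1) :
    ∃ R : ℝ, 0 < R ∧ ∀ M : ℝ, ∃ (W b q : ℝ → ℝ) (S : ℝ), Continuous q ∧ Monotone q ∧
      (∀ s, 0 < q s) ∧ (∀ s, q s ≤ S) ∧ (∀ s, α ≤ s → s ≤ M → n * q s = f (-s)) ∧
      W 0 = α ∧ b 0 = 0 ∧ (∀ r, HasDerivAt b (q (W r)) r) ∧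
      (∀ r, HasDerivAt W ((hA.fluxIso hA_top).symm (b r)) r) ∧ MonotoneOn W (Ici 0) ∧
      ∀ r, R ≤ r → M ≤ W r := by
  set e := hA.fluxIso hA_top with he
  have hes0 : e.symm 0 = 0 := hA.fluxIso_symm_zero hA_top
  obtain ⟨E, hE0, hEG, hEH⟩ := hA.exists_energyIso hA_top
  have hn0 : 0 < n := one_pos.trans_le hn
  set P : ℝ → ℝ := fun t => 1 / energyH A (∫ s in t..(-1 : ℝ), f s) with hP
  have hFpos : ∀ t, t < -1 → 0 < ∫ s in t..(-1 : ℝ), f s := fun t ht =>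
    intervalIntegral.intervalIntegral_pos_of_pos_on (hf.intervalIntegrable _ _)
      (fun x hx => hf_pos x (by linarith [hx.2])) ht
  have hPE : ∀ t, t < -1 → P t = 1 / E.symm (∫ s in t..(-1 : ℝ), f s) := fun t ht => by
    simp only [hP, hEH _ (hFpos t ht).le]
  have hEpos : ∀ y, 0 < y → 0 < E.symm y := fun y hy => by
    rw [E.lt_symm_apply, hE0]
    exact hy
  have hPpos : ∀ t, t < -1 → 0 < P t := fun t ht => by
    rw [hPE t ht]
    exact one_div_pos.2 (hEpos _ (hFpos t ht))
  have hPc : ContinuousOn P (Iio (-1)) := by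
    have hc : Continuous fun t => ∫ s in t..(-1 : ℝ), f s := by
      simp only [intervalIntegral.integral_symm (-1)]
      exact (intervalIntegral.continuous_primitive (fun a b => hf.intervalIntegrable a b) _).neg
    have : ContinuousOn (fun t => 1 / E.symm (∫ s in t..(-1 : ℝ), f s)) (Iio (-1)) :=
      continuousOn_const.div (E.symm.continuous.comp hc).continuousOn
        fun t ht => (hEpos _ (hFpos t ht)).ne'
    exact this.congr fun t ht => hPE t ht
  set c := f (-α) / n with hc
  have hcpos : 0 < c := div_pos (hf_pos _ (by linarith)) hn0
  set δ := e.symm c with hδ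
  have hδpos : 0 < δ := by
    rw [hδ, ← hes0]
    exact e.symm.strictMono hcpos
  set I := ∫ t in Iio (-1), P t with hI
  have hI0 : 0 ≤ I := setIntegral_nonneg measurableSet_Iio fun t ht => (hPpos t ht).le
  -- For `r ≥ 1` the flux is at least `c`, so `W' ≥ δ`; a further length `2 / δ` lifts `W` to height
  -- `2`. This keeps `T` below `-1`, where `P` is positive and continuous.
  set r₀ : ℝ := 1 + 2 / δ with hr₀
  have hr₀1 : 1 ≤ r₀ := by
    have : 0 < 2 / δ := by positivity
    linarith
  refine ⟨r₀ + n * I + 1, by positivity, fun M => ?_⟩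
  set R := r₀ + n * I + 1 with hR
  have hr₀R : r₀ ≤ R := by
    have : 0 ≤ n * I := by positivity
    linarith
  set m := max M 1 with hm
  have hm1 : 1 ≤ m := le_max_right _ _
  -- Clamping to `[α, m]` keeps `q` between positive constants, so that the profile is global, and
  -- keeps the argument of `f` negative.
  set k : ℝ → ℝ := fun s => max α (min s m) with hk
  have hkα : ∀ s, α ≤ k s := fun s => le_max_left _ _
  have hkm : ∀ s, k s ≤ m := fun s => max_le (hα1.trans hm1) (min_le_right _ _)
  have hkid : ∀ s, α ≤ s → s ≤ m → k s = s := fun s h1 h2 => by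
    rw [hk]
    simp [h1, h2]
  have hkmono : Monotone k := fun s t hst => max_le_max le_rfl (min_le_min hst le_rfl)
  have hqmono : Monotone fun s => f (-k s) / n := fun s t hst => by
    have := hf_anti (mem_Iio.2 (by linarith [hkα t])) (mem_Iio.2 (by linarith [hkα s]))
      (neg_le_neg (hkmono hst))
    simp only
    gcongr
  set q : ℝ → ℝ := fun s => f (-k s) / n with hq
  have hqc : Continuous q := by fun_prop
  have hcq : ∀ s, c ≤ q s := fun s => by
    have := hf_anti (mem_Iio.2 (by linarith [hkα s])) (mem_Iio.2 (by linarith))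
      (neg_le_neg (hkα s))
    simp only [hc, hq]
    gcongr
  have hqS : ∀ s, q s ≤ f (-m) / n := fun s => by
    have := hf_anti (mem_Iio.2 (by linarith)) (mem_Iio.2 (by linarith [hkα s]))
      (neg_le_neg (hkm s))
    simp only [hq]
    gcongr
  have hqf : ∀ s, α ≤ s → s ≤ m → q s = f (-s) / n := fun s h1 h2 => by
    simp only [hq, hkid s h1 h2]
  obtain ⟨W, b, hW0, hb0, hb', hW', hWb⟩ := exists_profile e.symm.continuous hqc hcpos hcq hqS α
  have hbc : Continuous b := continuous_iff_continuousAt.2 fun r => (hb' r).continuousAt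
  have hblow : ∀ r, 0 ≤ r → c * r ≤ b r := fun r hr => by
    have h := (convex_Ici (0 : ℝ)).mul_sub_le_image_sub_of_le_deriv (f := b) (C := c)
      hbc.continuousOn (fun x _ => (hb' x).differentiableAt.differentiableWithinAt)
      (fun x _ => by rw [(hb' x).deriv]; exact hcq _) 0 (mem_Ici.2 le_rfl) r hr hr
    simpa [hb0] using h
  have hWc : Continuous W := continuous_iff_continuousAt.2 fun r => (hW' r).continuousAt
  have hψ0 : ∀ r, 0 ≤ r → 0 ≤ e.symm (b r) := fun r hr => by
    rw [← hes0]
    exact e.symm.monotone ((by positivity : 0 ≤ c * r).trans (hblow r hr))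
  have hWmono : MonotoneOn W (Ici 0) := by
    refine monotoneOn_of_deriv_nonneg (convex_Ici 0) hWc.continuousOn
      (fun x _ => (hW' x).differentiableAt.differentiableWithinAt) fun x hx => ?_
    rw [interior_Ici] at hx
    rw [(hW' x).deriv]
    exact hψ0 x (le_of_lt hx)
  have hWr₀ : 2 ≤ W r₀ := by
    have h := (convex_Ici (1 : ℝ)).mul_sub_le_image_sub_of_le_deriv (f := W) (C := δ)
      hWc.continuousOn (fun x _ => (hW' x).differentiableAt.differentiableWithinAt)
      (fun x hx => by
        rw [interior_Ici, mem_Ioi] at hx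
        rw [(hW' x).deriv]
        refine e.symm.monotone (le_trans ?_ (hblow x (by linarith)))
        nlinarith) 1 (mem_Ici.2 le_rfl) r₀ hr₀1 hr₀1
    have h1 : α ≤ W 1 := hW0 ▸ hWmono (mem_Ici.2 le_rfl) (mem_Ici.2 zero_le_one) zero_le_one
    have h2 : δ * (r₀ - 1) = 2 := by
      rw [hr₀]
      field_simp
      ring
    linarith
  refine ⟨W, b, q, _, hqc, hqmono, fun s => hcpos.trans_le (hcq s), hqS, fun s h1 h2 => ?_, hW0,
    hb0, hb', hW', hWmono, fun r hr => ?_⟩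
  · rw [hqf s h1 (h2.trans (le_max_left _ _))]
    field_simp
  refine le_trans ?_ (hWmono (mem_Ici.2 (by linarith)) (mem_Ici.2 (by linarith)) hr)
  by_contra! hWR
  have hWR' : W R ≤ m := hWR.le.trans (le_max_left _ _)
  -- This substitution matches the convexity lemma, absorbing the factor `1 / n` in `q`.
  set T : ℝ → ℝ := fun r => -1 - (W r - 1) / n with hT
  have hT' : ∀ r, HasDerivAt T (-(e.symm (b r) / n)) r := fun r =>
    (((hW' r).sub_const 1).div_const n).const_sub (-1)
  have hW2 : ∀ r ∈ Icc r₀ R, 2 ≤ W r ∧ W r ≤ m := fun r hr =>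
    ⟨hWr₀.trans (hWmono (mem_Ici.2 (by linarith)) (mem_Ici.2 (by linarith [hr.1])) hr.1),
      (hWmono (mem_Ici.2 (by linarith [hr.1])) (mem_Ici.2 (by linarith)) hr.2).trans hWR'⟩
  have hT1 : ∀ r ∈ Icc r₀ R, T r < -1 := fun r hr => by
    have : 0 < (W r - 1) / n := div_pos (by linarith [(hW2 r hr).1]) hn0
    simp only [hT]
    linarith
  -- By Young's equality and the first integral, `G(W') = ∫_α^W q`. Dropping `[α, 1]` and applying
  -- convexity bounds this below by `∫_T^{-1} f`.
  have hkey : ∀ r ∈ Icc r₀ R, E.symm (∫ s in T r..(-1 : ℝ), f s) ≤ e.symm (b r) := fun r hr => by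
    obtain ⟨h2, hrm⟩ := hW2 r hr
    have hr0 : 0 ≤ r := by linarith [hr.1]
    rw [E.symm_apply_le, ← hEG _ (hψ0 r hr0), hA.energyG_eq hA_top (hψ0 r hr0), ← he,
      e.apply_symm_apply, ← hWb]
    refine (integral_le_integral_div_of_antitoneOn hf hf_anti hn (by linarith)).trans ?_
    have hii := fun x y : ℝ => hqc.intervalIntegrable (μ := volume) x y
    rw [← intervalIntegral.integral_add_adjacent_intervals (hii α 1) (hii 1 (W r))]
    have h1 : 0 ≤ ∫ s in α..1, q s :=
      intervalIntegral.integral_nonneg hα1 fun s _ => hcpos.le.trans (hcq s)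
    have h3 : ∫ s in (1 : ℝ)..W r, q s = ∫ s in (1 : ℝ)..W r, f (-s) / n := by
      refine intervalIntegral.integral_congr fun s hs => ?_
      rw [uIcc_of_le (by linarith)] at hs
      exact hqf s (hα1.trans hs.1) (hs.2.trans hrm)
    linarith
  have hsub := intervalIntegral.integral_comp_mul_deriv' (a := r₀) (b := R) (f := T) (g := P)
    (fun x _ => hT' x) (by
      have := e.symm.continuous.comp hbc
      exact (this.div_const n).neg.continuousOn) (hPc.mono (by
      rw [uIcc_of_le hr₀R]
      rintro _ ⟨r, hr, rfl⟩
      exact hT1 r hr))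
  have hTle : T R ≤ T r₀ := by
    have := hWmono (mem_Ici.2 (by linarith)) (mem_Ici.2 (by linarith)) hr₀R
    simp only [hT]
    gcongr
  have hle : ∫ t in T R..T r₀, P t ≤ I := by
    rw [intervalIntegral.integral_of_le hTle]
    refine setIntegral_mono_set hf_int ?_ (Eventually.of_forall fun t ht => ?_)
    · filter_upwards [self_mem_ae_restrict measurableSet_Iio] with t ht
      exact (hPpos t ht).le
    · exact ht.2.trans_lt (hT1 r₀ ⟨le_rfl, hr₀R⟩)
  -- Since `-T' = W' / n`, the previous estimate gives `-P(T) T' ≥ 1 / n`. The choice of `R` makes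
  -- the left side `I + 1 / n`, exceeding the whole integral.
  have hge : (R - r₀) * (1 / n) ≤ ∫ t in T R..T r₀, P t := by
    rw [intervalIntegral.integral_symm, ← hsub, ← intervalIntegral.integral_neg,
      ← smul_eq_mul, ← intervalIntegral.integral_const]
    refine intervalIntegral.integral_mono_on hr₀R (by simp) ?_ fun r hr => ?_
    · refine ContinuousOn.intervalIntegrable ?_
      rw [uIcc_of_le hr₀R]
      have h1 : ContinuousOn (P ∘ T) (Icc r₀ R) :=
        hPc.comp (fun r _ => (hT' r).continuousAt.continuousWithinAt) hT1
      have h2 := e.symm.continuous.comp hbc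
      exact (h1.mul (h2.div_const n).neg.continuousOn).neg
    · have h1 := hEpos _ (hFpos _ (hT1 r hr))
      rw [Function.comp_apply, hPE _ (hT1 r hr), mul_neg, neg_neg, ← mul_div_assoc]
      gcongr
      rw [one_div_mul_eq_div, one_le_div h1]
      exact hkey r hr
  have h1 : (R - r₀) * (1 / n) = I + 1 / n := by
    rw [hR]
    field_simp
    ring
  have h2 : 0 < 1 / n := by positivity
  linarith

/-! ### Radial functions and the divergence of radial fields -/

section Radial

variable {V : Type*} [NormedAddCommGroup V] [InnerProductSpace ℝ V]

theorem hasFDerivAt_norm_of_ne_zero {x : V} (hx : x ≠ 0) :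
    HasFDerivAt (fun y : V => ‖y‖) (‖x‖⁻¹ • innerSL ℝ x) x := by
  have h := (hasStrictFDerivAt_norm_sq x).hasFDerivAt.sqrt (by simpa using hx)
  simp only [Real.sqrt_sq (norm_nonneg _)] at h
  refine h.congr_fderiv ?_
  ext y
  have : ‖x‖ ≠ 0 := norm_ne_zero_iff.2 hx
  simp
  field_simp

theorem hasFDerivAt_comp_norm {W : ℝ → ℝ} {p : ℝ} {x : V} (hW : HasDerivAt W p ‖x‖)
    (hp : x = 0 → p = 0) : HasFDerivAt (fun y : V => W ‖y‖) ((p / ‖x‖) • innerSL ℝ x) x := by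
  by_cases hx : x = 0
  · subst hx
    rw [hp rfl, norm_zero] at hW
    rw [hp rfl]
    have h1 := hasDerivAt_iff_isLittleO.1 hW
    have h2 : Tendsto (fun y : V => ‖y‖) (nhds 0) (nhds 0) := by
      simpa using (continuous_norm (E := V)).tendsto 0
    refine HasFDerivAt.of_isLittleO ?_
    simpa [Function.comp_def] using (h1.comp_tendsto h2).trans_isBigO (by
      simpa [Function.comp_def] using (Asymptotics.isBigO_refl (fun y : V => y) (nhds 0)).norm_left)
  · refine (hW.comp_hasFDerivAt x (hasFDerivAt_norm_of_ne_zero hx)).congr_fderiv ?_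
    rw [smul_smul, div_eq_mul_inv]

theorem norm_div_norm_smul_self (p : ℝ) {x : V} (hp : x = 0 → p = 0) :
    ‖(p / ‖x‖) • x‖ = |p| := by
  by_cases hx : x = 0
  · simp [hp hx]
  · rw [norm_smul, norm_div, norm_norm, div_mul_cancel₀ _ (norm_ne_zero_iff.2 hx), Real.norm_eq_abs]

theorem continuous_div_norm_smul_self {p : ℝ → ℝ} (hp : Continuous p) (hp0 : p 0 = 0) :
    Continuous fun x : V => (p ‖x‖ / ‖x‖) • x := by
  refine continuous_iff_continuousAt.2 fun x => ?_
  by_cases hx : x = 0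
  · subst hx
    have h : Tendsto (fun x : V => |p ‖x‖|) (nhds 0) (nhds 0) := by
      have : Continuous fun x : V => |p ‖x‖| := by fun_prop
      simpa [hp0] using this.tendsto 0
    rw [ContinuousAt]
    simp only [smul_zero]
    refine squeeze_zero_norm (fun y => ?_) h
    exact (norm_div_norm_smul_self _ fun h => by rw [h, norm_zero, hp0]).le
  · have : ‖x‖ ≠ 0 := norm_ne_zero_iff.2 hx
    have h : ContinuousAt (fun x : V => p ‖x‖) x := by fun_prop
    exact (h.div continuous_norm.continuousAt this).smul continuousAt_id

-- These are the diagonal entries of the derivative of the field `b(r)x/r`. Summed over an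
-- orthonormal basis they give its divergence, `b' + (n-1)b/r` away from the origin and `n b'(0)` at
-- it.
open Classical in
theorem hasLineDerivAt_div_norm_mul_inner {b : ℝ → ℝ} {b' : ℝ} {x v : V} (hb0 : b 0 = 0)
    (hb : HasDerivAt b b' ‖x‖) (hv : ‖v‖ = 1) :
    HasLineDerivAt ℝ (fun y : V => b ‖y‖ / ‖y‖ * inner ℝ v y)
      (if x = 0 then b' else
        b ‖x‖ / ‖x‖ + (b' / ‖x‖ ^ 2 - b ‖x‖ / ‖x‖ ^ 3) * inner ℝ v x ^ 2) x v := by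
  split_ifs with hx
  · subst hx
    have hvv : inner ℝ v v = 1 := by simp [hv]
    rw [norm_zero, hasDerivAt_iff_isLittleO] at hb
    have h2 : Tendsto (fun t : ℝ => |t|) (nhds 0) (nhds 0) := by
      simpa using (continuous_abs (G := ℝ)).tendsto 0
    refine hasDerivAt_iff_isLittleO.2 ?_
    have h3 := (hb.comp_tendsto h2).norm_left
    simp only [Function.comp_def, hb0, sub_zero] at h3
    refine Asymptotics.IsLittleO.of_norm_left ?_
    refine (h3.trans_isBigO (Asymptotics.isBigO_refl (fun t : ℝ => t) _).abs_left).congr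
      (fun t => ?_) (fun t => by simp)
    by_cases ht : t = 0
    · simp [ht, hb0]
    · have ht' : |t| ≠ 0 := abs_ne_zero.2 ht
      have : b |t| / |t| * t - t * b' = t / |t| * (b |t| - |t| * b') := by
        field_simp
      simp [norm_smul, inner_smul_right, hv, this, ht']
  · have hr : ‖x‖ ≠ 0 := norm_ne_zero_iff.2 hx
    have h1 := hasFDerivAt_comp_norm (hb.div (hasDerivAt_id ‖x‖) hr) fun h => absurd h hx
    have h2 := (h1.mul (innerSL ℝ v).hasFDerivAt).hasLineDerivAt v
    refine HasDerivAt.congr_deriv (h2 : HasDerivAt _ _ _) ?_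
    simp [hv, real_inner_comm]
    field_simp

variable [FiniteDimensional ℝ V] [MeasurableSpace V] [BorelSpace V]

/-- Integration by parts in each coordinate reduces this to `b' + (n-1)b/r ≤ n b'`, which is `b ≤ r
b'`. -/
theorem integral_inner_radial_gradient_ge {b b' : ℝ → ℝ} {S : ℝ} (hb0 : b 0 = 0)
    (hb : ∀ r, HasDerivAt b (b' r) r) (hb'c : Continuous b') (hb'0 : ∀ r, 0 ≤ b' r)
    (hb'S : ∀ r, b' r ≤ S) (hbb' : ∀ r, 0 ≤ r → b r ≤ r * b' r)
    (hV : 1 ≤ Module.finrank ℝ V) {φ : V → ℝ} (hφ : ContDiff ℝ 1 φ) (hφc : HasCompactSupport φ)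
    (hφ0 : ∀ x, 0 ≤ φ x) :
    -∫ x, Module.finrank ℝ V * b' ‖x‖ * φ x ≤
      ∫ x, inner ℝ ((b ‖x‖ / ‖x‖) • x) (gradient φ x) := by
  classical
  set n := Module.finrank ℝ V with hn
  set B := stdOrthonormalBasis ℝ V
  have hbc : Continuous b := continuous_iff_continuousAt.2 fun r => (hb r).continuousAt
  set X : V → V := fun x => (b ‖x‖ / ‖x‖) • x with hX
  have hXc : Continuous X := continuous_div_norm_smul_self hbc hb0
  have hφ' : ∀ x v, inner ℝ v (gradient φ x) = fderiv ℝ φ x v := fun x v => by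
    rw [real_inner_comm, inner_gradient_left]
  have hdc : ∀ v, Continuous fun x => fderiv ℝ φ x v := fun v =>
    (hφ.continuous_fderiv one_ne_zero).clm_apply continuous_const
  have hds : ∀ v, HasCompactSupport fun x => fderiv ℝ φ x v := fun v =>
    hφc.fderiv_apply ℝ v
  set Y : Fin n → V → ℝ := fun i x => b ‖x‖ / ‖x‖ * inner ℝ (B i) x with hY
  have hYX : ∀ i x, Y i x = inner ℝ (X x) (B i) := fun i x => by
    simp only [hY, hX, real_inner_smul_left, real_inner_comm x]
  have hYc : ∀ i, Continuous (Y i) := fun i => by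
    simp only [funext (hYX i)]
    fun_prop
  set D : Fin n → V → ℝ := fun i x => if x = 0 then b' ‖x‖ else
    b ‖x‖ / ‖x‖ + (b' ‖x‖ / ‖x‖ ^ 2 - b ‖x‖ / ‖x‖ ^ 3) * inner ℝ (B i) x ^ 2 with hD
  have hYD : ∀ i x, HasLineDerivAt ℝ (Y i) (D i x) x (B i) := fun i x =>
    hasLineDerivAt_div_norm_mul_inner hb0 (hb _) (B.norm_eq_one i)
  have hb_nonneg : ∀ r, 0 ≤ r → 0 ≤ b r := fun r hr => by
    rw [← hb0]
    exact monotone_of_deriv_nonneg (fun r => (hb r).differentiableAt)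
      (fun r => (hb r).deriv ▸ hb'0 r) hr
  have hDm : ∀ i, Measurable (D i) := fun i => by
    refine Measurable.ite (measurableSet_singleton 0) (by fun_prop) (by fun_prop)
  -- Off the origin `D i x` is a convex combination of `b / r` and `b'`, both in `[0, S]`; the
  -- factor `3` is slack.
  have hDS : ∀ i x, ‖D i x‖ ≤ 3 * S := fun i x => by
    have hS : 0 ≤ S := (hb'0 0).trans (hb'S 0)
    simp only [hD]
    split_ifs with hx
    · rw [Real.norm_eq_abs, abs_of_nonneg (hb'0 _)]
      linarith [hb'S ‖x‖]
    · have hr : 0 < ‖x‖ := norm_pos_iff.2 hx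
      have h1 : 0 ≤ b ‖x‖ / ‖x‖ := div_nonneg (hb_nonneg _ hr.le) hr.le
      have h2 : b ‖x‖ / ‖x‖ ≤ b' ‖x‖ := by
        rw [div_le_iff₀' hr]
        exact hbb' _ hr.le
      have h3 : |inner ℝ (B i) x| ≤ ‖x‖ := by
        simpa using abs_real_inner_le_norm (B i) x
      have h4 : inner ℝ (B i) x ^ 2 / ‖x‖ ^ 2 ≤ 1 := by
        rw [div_le_one (by positivity), sq_le_sq, abs_norm]
        exact h3
      have h5 : 0 ≤ inner ℝ (B i) x ^ 2 / ‖x‖ ^ 2 := by positivity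
      have h6 : (b' ‖x‖ / ‖x‖ ^ 2 - b ‖x‖ / ‖x‖ ^ 3) * inner ℝ (B i) x ^ 2 =
          (b' ‖x‖ - b ‖x‖ / ‖x‖) * (inner ℝ (B i) x ^ 2 / ‖x‖ ^ 2) := by
        field_simp
      have h7 := hb'S ‖x‖
      rw [h6, Real.norm_eq_abs, abs_of_nonneg]
      · have := mul_le_of_le_one_right (sub_nonneg.2 h2) h4
        linarith
      · have := mul_nonneg (sub_nonneg.2 h2) h5
        linarith
  have hφi : Integrable φ := hφ.continuous.integrable_of_hasCompactSupport hφc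
  have hDφ : ∀ i, Integrable fun x => D i x * φ x := fun i =>
    hφi.bdd_mul (hDm i).aestronglyMeasurable (Eventually.of_forall (hDS i))
  have hYφ' : ∀ i, Integrable fun x => Y i x * fderiv ℝ φ x (B i) := fun i =>
    ((hYc i).mul (hdc _)).integrable_of_hasCompactSupport ((hds _).mul_left)
  have hYφ : ∀ i, Integrable fun x => Y i x * φ x := fun i =>
    ((hYc i).mul hφ.continuous).integrable_of_hasCompactSupport hφc.mul_left
  have hparts : ∀ i, ∫ x, Y i x * fderiv ℝ φ x (B i) = -∫ x, D i x * φ x := fun i =>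
    integral_bilinear_hasLineDerivAt_right_eq_neg_left_of_integrable
      (B := ContinuousLinearMap.mul ℝ ℝ) (hDφ i) (hYφ' i) (hYφ i) (fun x _ => hYD i x)
      fun x _ => (hφ.differentiable one_ne_zero x).hasFDerivAt.hasLineDerivAt _
  have hsum : ∀ x, inner ℝ (X x) (gradient φ x) = ∑ i, Y i x * fderiv ℝ φ x (B i) := fun x => by
    rw [← B.sum_inner_mul_inner]
    exact Finset.sum_congr rfl fun i _ => by rw [hYX, hφ']
  have hdiv : ∀ x, ∑ i, D i x ≤ n * b' ‖x‖ := fun x => by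
    simp only [hD]
    split_ifs with hx
    · simp
    · have hr : 0 < ‖x‖ := norm_pos_iff.2 hx
      have h2 : b ‖x‖ / ‖x‖ ≤ b' ‖x‖ := by
        rw [div_le_iff₀' hr]
        exact hbb' _ hr.le
      have hn1 : (0 : ℝ) ≤ n - 1 := by
        rw [sub_nonneg]
        exact_mod_cast hV
      rw [Finset.sum_add_distrib, ← Finset.mul_sum, B.sum_sq_inner_right]
      have : (b' ‖x‖ / ‖x‖ ^ 2 - b ‖x‖ / ‖x‖ ^ 3) * ‖x‖ ^ 2 = b' ‖x‖ - b ‖x‖ / ‖x‖ := by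
        field_simp
      rw [this, Finset.sum_const, Finset.card_univ, Fintype.card_fin, nsmul_eq_mul]
      nlinarith
  simp only [← hX] at *
  calc -∫ x, n * b' ‖x‖ * φ x ≤ -∫ x, ∑ i, D i x * φ x := by
        refine neg_le_neg (integral_mono (integrable_finsetSum _ fun i _ => hDφ i) ?_ fun x => ?_)
        · exact Continuous.integrable_of_hasCompactSupport
            ((by fun_prop : Continuous fun x : V => n * b' ‖x‖).mul hφ.continuous) hφc.mul_left
        · simp only [← Finset.sum_mul]
          exact mul_le_mul_of_nonneg_right (hdiv x) (hφ0 x)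
    _ = ∑ i, ∫ x, Y i x * fderiv ℝ φ x (B i) := by
        rw [integral_finsetSum _ fun i _ => hDφ i, ← Finset.sum_neg_distrib]
        exact Finset.sum_congr rfl fun i _ => (hparts i).symm
    _ = ∫ x, inner ℝ (X x) (gradient φ x) := by
        simp only [hsum]
        rw [integral_finsetSum _ fun i _ => hYφ' i]

end Radial

/-! ### Regularity of test functions and monotonicity of the vector flux -/

theorem hasDerivAt_max_zero_sq (s : ℝ) :
    HasDerivAt (fun s : ℝ => max s 0 ^ 2) (2 * max s 0) s := by
  rcases lt_trichotomy s 0 with hs | rfl | hs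
  · have : (fun s : ℝ => max s 0 ^ 2) =ᶠ[nhds s] fun _ => 0 := by
      filter_upwards [Iio_mem_nhds hs] with t ht
      simp [max_eq_right (le_of_lt (mem_Iio.1 ht))]
    rw [max_eq_right hs.le, mul_zero]
    exact (hasDerivAt_const s 0).congr_of_eventuallyEq this
  · rw [max_self, mul_zero, hasDerivAt_iff_isLittleO]
    have h : (fun t : ℝ => t ^ 2) =o[nhds 0] fun t => t := by
      simpa using Asymptotics.isLittleO_pow_pow (𝕜 := ℝ) one_lt_two
    refine (Asymptotics.IsBigO.of_bound 1 (Eventually.of_forall fun t => ?_)).trans_isLittleO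
      (by simpa using h)
    simp only [max_self, sub_zero, smul_zero, norm_pow, Real.norm_eq_abs, one_mul, ne_eq,
      OfNat.ofNat_ne_zero, not_false_eq_true, zero_pow]
    refine pow_le_pow_left₀ (abs_nonneg _) ?_ 2
    rw [abs_of_nonneg (le_max_right t 0)]
    exact max_le (le_abs_self t) (abs_nonneg t)
  · have : (fun s : ℝ => max s 0 ^ 2) =ᶠ[nhds s] fun t => t ^ 2 := by
      filter_upwards [Ioi_mem_nhds hs] with t ht
      rw [max_eq_left (le_of_lt (mem_Ioi.1 ht))]
    rw [max_eq_left hs.le]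
    simpa using (hasDerivAt_pow 2 s).congr_of_eventuallyEq this

/-- Test functions must be `C¹`; the positive part is not, but its square is. -/
theorem contDiff_max_zero_sq : ContDiff ℝ 1 fun s : ℝ => max s 0 ^ 2 := by
  rw [contDiff_one_iff_deriv]
  refine ⟨fun s => (hasDerivAt_max_zero_sq s).differentiableAt, ?_⟩
  rw [show deriv (fun s : ℝ => max s 0 ^ 2) = fun s => 2 * max s 0 from
    funext fun s => (hasDerivAt_max_zero_sq s).deriv]
  fun_prop

theorem ContDiff.continuous_gradient {V : Type*} [NormedAddCommGroup V] [InnerProductSpace ℝ V]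
    [CompleteSpace V] {u : V → ℝ} (hu : ContDiff ℝ 1 u) : Continuous (gradient u) :=
  (InnerProductSpace.toDual ℝ V).symm.continuous.comp (hu.continuous_fderiv one_ne_zero)

namespace IsQuasilinearCoeff

variable {V : Type*} [NormedAddCommGroup V] [InnerProductSpace ℝ V] {A : ℝ → ℝ}

theorem continuous_vectorFlux (hA : IsQuasilinearCoeff A) :
    Continuous fun p : V => A ‖p‖ • p := by
  refine (continuous_div_norm_smul_self hA.continuous_flux (by simp)).congr fun p => ?_
  by_cases hp : p = 0
  · simp [hp]
  · have : ‖p‖ ≠ 0 := norm_ne_zero_iff.2 hp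
    rw [abs_norm, mul_div_cancel_left₀ _ this]

/-- The product splits into a scalar monotonicity term and two nonnegative Cauchy-Schwarz defects.
The scalar term is strict when the norms differ; when they agree the product is `A ‖p‖ * ‖p - q‖ ^
2`. -/
theorem inner_vectorFlux_sub_pos (hA : IsQuasilinearCoeff A) {p q : V} (hpq : p ≠ q) :
    0 < inner ℝ (A ‖p‖ • p - A ‖q‖ • q) (p - q) := by
  have hnn : ∀ x y : V, 0 ≤ A ‖x‖ * (‖x‖ * ‖y‖ - inner ℝ x y) := fun x y => by
    by_cases hx : x = 0
    · simp [hx]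
    · exact mul_nonneg (hA.pos _ (norm_pos_iff.2 hx)).le (sub_nonneg.2 (real_inner_le_norm x y))
  have hexp : inner ℝ (A ‖p‖ • p - A ‖q‖ • q) (p - q) =
      (‖p‖ * A ‖p‖ - ‖q‖ * A ‖q‖) * (‖p‖ - ‖q‖) + A ‖p‖ * (‖p‖ * ‖q‖ - inner ℝ p q) +
        A ‖q‖ * (‖q‖ * ‖p‖ - inner ℝ q p) := by
    simp only [inner_sub_left, inner_sub_right, real_inner_smul_left,
      real_inner_self_eq_norm_sq]
    ring
  have h1 := hnn p q
  have h2 := hnn q p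
  rcases lt_trichotomy ‖p‖ ‖q‖ with h | h | h
  · have h3 := hA.strictMono_flux h
    simp only [abs_norm] at h3
    have := mul_pos_of_neg_of_neg (sub_neg.2 h3) (sub_neg.2 h)
    linarith
  · have hp : 0 < ‖p‖ := by
      rcases (norm_nonneg p).eq_or_lt with h0 | h0
      · exact absurd ((norm_eq_zero.1 h0.symm).trans (norm_eq_zero.1 (h ▸ h0.symm)).symm) hpq
      · exact h0
    have : inner ℝ (A ‖p‖ • p - A ‖q‖ • q) (p - q) = A ‖p‖ * ‖p - q‖ ^ 2 := by
      rw [← h, ← smul_sub, real_inner_smul_left, real_inner_self_eq_norm_sq]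
    rw [this]
    have := hA.pos _ hp
    have : 0 < ‖p - q‖ := norm_pos_iff.2 (sub_ne_zero.2 hpq)
    positivity
  · have h3 := hA.strictMono_flux h
    simp only [abs_norm] at h3
    have := mul_pos (sub_pos.2 h3) (sub_pos.2 h)
    linarith

end IsQuasilinearCoeff

/-! ### Translation and comparison with the radial barrier -/

theorem IsWeakSupersolution.comp_add_right {N : ℕ} {A : ℝ → ℝ}
    {h u : EuclideanSpace ℝ (Fin N) → ℝ} (hu : IsWeakSupersolution A h u)
    (y : EuclideanSpace ℝ (Fin N)) :
    IsWeakSupersolution A (fun x => h (x + y)) fun x => u (x + y) := by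
  have hgrad : ∀ (g : EuclideanSpace ℝ (Fin N) → ℝ) y x,
      gradient (fun x => g (x + y)) x = gradient g (x + y) := fun g y x => by
    simp only [gradient, fderiv_comp_add_right]
  refine ⟨hu.contDiff.comp (contDiff_id.add contDiff_const), fun φ hφ hφc hφ0 => ?_⟩
  have key := hu.weak_ineq (fun x => φ (x + -y)) (hφ.comp (contDiff_id.add contDiff_const))
    (hφc.comp_homeomorph (Homeomorph.addRight (-y))) fun x => hφ0 _
  rw [← integral_add_right_eq_self _ y,
    ← integral_add_right_eq_self (fun x => inner ℝ (A ‖gradient u x‖ • gradient u x) _) y] at key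
  simpa only [hgrad, add_neg_cancel_right] using key

theorem IsWeakSupersolution.nonneg_zero {N : ℕ} (hN : 1 ≤ N) {A : ℝ → ℝ}
    (hA : IsQuasilinearCoeff A) (hA_top : Tendsto (fun t : ℝ => t * A t) atTop atTop)
    {f : ℝ → ℝ} (hf : Continuous f) (hf_pos : ∀ t : ℝ, t < 0 → 0 < f t)
    (hf_anti : AntitoneOn f (Iio 0))
    (hf_int : IntegrableOn (fun t : ℝ => 1 / energyH A (∫ s in t..(-1 : ℝ), f s)) (Iio (-1)))
    {u : EuclideanSpace ℝ (Fin N) → ℝ} (hu : IsWeakSupersolution A (fun x => f (u x)) u) :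
    0 ≤ u 0 := by
  by_contra! hu0
  obtain ⟨α, hα, hα'⟩ : ∃ α, 0 < α ∧ α < min 1 (-u 0) :=
    exists_between (lt_min one_pos (neg_pos.2 hu0))
  obtain ⟨hα1, hαu⟩ := lt_min_iff.1 hα'
  obtain ⟨R, hR, hprof⟩ := exists_radius_forall_exists_profile hA hA_top hf hf_pos hf_anti hf_int
    (n := N) (by exact_mod_cast hN) hα hα1.le
  have huc := hu.contDiff.continuous
  obtain ⟨M, hM⟩ :=
    (isCompact_closedBall (0 : EuclideanSpace ℝ (Fin N)) (R + 1)).bddAbove_image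
      huc.neg.continuousOn
  replace hM : ∀ x : EuclideanSpace ℝ (Fin N), ‖x‖ ≤ R + 1 → -u x ≤ M := fun x hx =>
    hM ⟨x, mem_closedBall_zero_iff.2 hx, rfl⟩
  obtain ⟨W, b, q, S, hqc, hqmono, hqpos, hqS, hqf, hW0, hb0, hb', hW', hWmono, hWM⟩ := hprof M
  set e := hA.fluxIso hA_top with he
  have hes0 : e.symm 0 = 0 := hA.fluxIso_symm_zero hA_top
  have hbc : Continuous b := continuous_iff_continuousAt.2 fun r => (hb' r).continuousAt
  have hWc : Continuous W := continuous_iff_continuousAt.2 fun r => (hW' r).continuousAt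
  have hb_nonneg : ∀ r, 0 ≤ r → 0 ≤ b r := fun r hr => by
    rw [← hb0]
    exact monotone_of_deriv_nonneg (fun r => (hb' r).differentiableAt)
      (fun r => (hb' r).deriv ▸ (hqpos _).le) hr
  have hWα : ∀ x : EuclideanSpace ℝ (Fin N), α ≤ W ‖x‖ := fun x => by
    rw [← hW0]
    exact hWmono (mem_Ici.2 le_rfl) (norm_nonneg x) (norm_nonneg x)
  -- Both `q` and `W` are nondecreasing, so `b'` is largest at the right end of `[0, r]`.
  have hbb' : ∀ r, 0 ≤ r → b r ≤ r * q (W r) := fun r hr => by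
    have h := (convex_Icc 0 r).image_sub_le_mul_sub_of_deriv_le (f := b) (C := q (W r))
      hbc.continuousOn (fun x _ => (hb' x).differentiableAt.differentiableWithinAt)
      (fun x hx => by
        rw [(hb' x).deriv]
        have hx' := interior_subset hx
        exact hqmono (hWmono hx'.1 hr hx'.2)) 0 ⟨le_rfl, hr⟩ r ⟨hr, le_rfl⟩ hr
    rw [hb0] at h
    linarith
  -- the gradient of the radial profile and its flux
  set p : EuclideanSpace ℝ (Fin N) → EuclideanSpace ℝ (Fin N) := fun x =>
    (e.symm (b ‖x‖) / ‖x‖) • x with hp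
  have hψ0 : ∀ x : EuclideanSpace ℝ (Fin N), x = 0 → e.symm (b ‖x‖) = 0 := fun x hx => by
    rw [hx, norm_zero, hb0, hes0]
  have hpc : Continuous p := continuous_div_norm_smul_self (e.symm.continuous.comp hbc)
    (by simp [hb0, hes0])
  have hWp : ∀ x : EuclideanSpace ℝ (Fin N),
      HasGradientAt (fun y : EuclideanSpace ℝ (Fin N) => W ‖y‖) (p x) x := fun x => by
    rw [hasGradientAt_iff_hasFDerivAt]
    refine (hasFDerivAt_comp_norm (hW' ‖x‖) (hψ0 x)).congr_fderiv ?_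
    ext y
    simp [hp]
  have hflux : ∀ x, A ‖p x‖ • p x = (b ‖x‖ / ‖x‖) • x := fun x => by
    have h0 : 0 ≤ e.symm (b ‖x‖) := by
      rw [← hes0]
      exact e.symm.monotone (hb_nonneg _ (norm_nonneg x))
    have h1 : b ‖x‖ = e.symm (b ‖x‖) * A (e.symm (b ‖x‖)) := by
      conv_lhs => rw [← e.apply_symm_apply (b ‖x‖)]
      rw [he, hA.fluxIso_apply hA_top, ← he, abs_of_nonneg h0]
    rw [hp, norm_div_norm_smul_self _ (hψ0 x), abs_of_nonneg h0, smul_smul, h1,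
      ← h1]
    congr 1
    rw [← mul_div_assoc, mul_comm, ← h1]
  -- the test function
  set d : EuclideanSpace ℝ (Fin N) → ℝ := fun x => -u x - W ‖x‖ with hd
  have hdgrad : ∀ x, HasFDerivAt d (innerSL ℝ (-gradient u x - p x)) x := fun x => by
    have h1 := (hu.contDiff.differentiable one_ne_zero x).hasGradientAt.hasFDerivAt
    have h2 := (hWp x).hasFDerivAt
    refine (h1.neg.sub h2).congr_fderiv ?_
    ext y
    simp
  have hgc : Continuous (gradient u) := hu.contDiff.continuous_gradient
  have hd1 : ContDiff ℝ 1 d := by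
    rw [contDiff_one_iff_fderiv]
    refine ⟨fun x => (hdgrad x).differentiableAt, ?_⟩
    rw [show fderiv ℝ d = fun x => innerSL ℝ (-gradient u x - p x) from
      funext fun x => (hdgrad x).fderiv]
    exact (innerSL ℝ).continuous.comp (hgc.neg.sub hpc)
  let η : ContDiffBump (0 : EuclideanSpace ℝ (Fin N)) := ⟨R, R + 1, hR, by linarith⟩
  have hdM : ∀ x : EuclideanSpace ℝ (Fin N), R ≤ ‖x‖ → ‖x‖ ≤ R + 1 → d x ≤ 0 := fun x h1 h2 => by
    have h3 := hM x h2
    have h4 := hWM _ h1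
    simp only [hd]
    linarith
  set φ : EuclideanSpace ℝ (Fin N) → ℝ := fun x => max (d x) 0 ^ 2 * η x with hφ
  have hφ1 : ContDiff ℝ 1 φ := (contDiff_max_zero_sq.comp hd1).mul η.contDiff
  have hφc : HasCompactSupport φ := η.hasCompactSupport.mul_left
  have hφ0 : ∀ x, 0 ≤ φ x := fun x => mul_nonneg (sq_nonneg _) η.nonneg
  -- The term with the gradient of `η` drops out: that gradient vanishes for `‖x‖ < R` and `‖x‖ > R
  -- + 1`, and `d ≤ 0` in between.
  have hφgrad : ∀ x, gradient φ x = (2 * max (d x) 0 * η x) • (-gradient u x - p x) := fun x => by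
    have h1 : HasFDerivAt φ _ x := ((hasDerivAt_max_zero_sq (d x)).comp_hasFDerivAt x
      (hdgrad x)).mul ((η.contDiff (n := 1)).differentiable one_ne_zero x).hasFDerivAt
    have h2 : max (d x) 0 ^ 2 • fderiv ℝ η x = 0 := by
      by_cases hdx : d x ≤ 0
      · simp [max_eq_right hdx]
      suffices fderiv ℝ η x = 0 by rw [this, smul_zero]
      rcases lt_or_ge ‖x‖ R with hx | hx
      · rw [(η.eventuallyEq_one_of_mem_ball (mem_ball_zero_iff.2 hx)).fderiv_eq]
        simp
      · have hx' : R + 1 < ‖x‖ := by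
          by_contra! h
          exact hdx (hdM x hx h)
        have : η =ᶠ[nhds x] fun _ => (0 : ℝ) := by
          filter_upwards [(isOpen_lt continuous_const continuous_norm).mem_nhds hx'] with y hy
          exact η.zero_of_le_dist (by simpa using hy.le)
        rw [this.fderiv_eq]
        simp
    refine HasGradientAt.gradient (hasGradientAt_iff_hasFDerivAt.2 (h1.congr_fderiv ?_))
    rw [Function.comp_apply, h2]
    ext y
    simp
    ring
  have hweak := hu.weak_ineq φ hφ1 hφc hφ0
  have hrad := integral_inner_radial_gradient_ge hb0 hb' (hqc.comp hWc) (fun r => (hqpos _).le)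
    (fun r => hqS _) hbb' (by simpa using hN) hφ1 hφc hφ0
  simp only [← hflux] at hrad
  rw [finrank_euclideanSpace_fin] at hrad
  have hgφc : Continuous (gradient φ) := hφ1.continuous_gradient
  have hgφs : HasCompactSupport (gradient φ) :=
    hφc.fderiv ℝ |>.comp_left
      (map_zero (InnerProductSpace.toDual ℝ (EuclideanSpace ℝ (Fin N))).symm)
  have hX1 : Continuous fun x => A ‖gradient u x‖ • gradient u x :=
    hA.continuous_vectorFlux.comp hgc
  have hX2 : Continuous fun x => A ‖p x‖ • p x := hA.continuous_vectorFlux.comp hpc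
  have hinner : ∀ X : EuclideanSpace ℝ (Fin N) → EuclideanSpace ℝ (Fin N), Continuous X →
      Continuous (fun x => inner ℝ (X x) (gradient φ x)) ∧
        HasCompactSupport fun x => inner ℝ (X x) (gradient φ x) := fun X hX =>
    ⟨hX.inner hgφc, hgφs.mono fun x hx h0 => hx (by simp [h0])⟩
  have hint : ∀ X : EuclideanSpace ℝ (Fin N) → EuclideanSpace ℝ (Fin N), Continuous X →
      Integrable fun x => inner ℝ (X x) (gradient φ x) :=
    fun X hX => (hinner X hX).1.integrable_of_hasCompactSupport (hinner X hX).2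
  have hi1 : Integrable fun x => f (u x) * φ x :=
    ((hf.comp huc).mul hφ1.continuous).integrable_of_hasCompactSupport hφc.mul_left
  have hi2 : Integrable fun x => N * q (W ‖x‖) * φ x :=
    ((by fun_prop : Continuous fun x : EuclideanSpace ℝ (Fin N) => N * q (W ‖x‖)).mul
      hφ1.continuous).integrable_of_hasCompactSupport hφc.mul_left
  -- Where `φ` is nonzero, `u < -W < 0` and `W ≤ M`, so `N q(W) = f(-W) ≤ f(u)`.
  have hle : ∫ x, N * q (W ‖x‖) * φ x ≤ ∫ x, f (u x) * φ x := by
    refine integral_mono hi2 hi1 fun x => ?_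
    by_cases hφx : φ x = 0
    · simp [hφx]
    refine mul_le_mul_of_nonneg_right ?_ (hφ0 x)
    have hdx : 0 < d x := by
      by_contra! h
      exact hφx (by simp [hφ, max_eq_right h])
    have hx : ‖x‖ ≤ R + 1 := by
      by_contra! h
      exact hφx (by simp [hφ, η.zero_of_le_dist (x := x) (by simpa using h.le)])
    have hux : W ‖x‖ < -u x := by
      simp only [hd] at hdx
      linarith
    have hWx := hWα x
    rw [hqf _ hWx (hux.le.trans (hM x hx))]
    exact hf_anti (mem_Iio.2 (by linarith)) (mem_Iio.2 (by linarith)) (by linarith)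
  set X : EuclideanSpace ℝ (Fin N) → EuclideanSpace ℝ (Fin N) := fun x =>
    A ‖p x‖ • p x + A ‖gradient u x‖ • gradient u x with hX
  have hXc : Continuous X := hX2.add hX1
  have hI : 0 ≤ ∫ x, inner ℝ (X x) (gradient φ x) := by
    simp only [hX, inner_add_left]
    rw [integral_add (hint _ hX2) (hint _ hX1)]
    linarith
  -- Strict monotonicity for `p` and `-∇u`; the flux is odd, so the flux of `-∇u` is minus that of
  -- `∇u`.
  have hJ : ∀ x, p x ≠ -gradient u x → inner ℝ (X x) (-gradient u x - p x) < 0 := fun x hx => by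
    have h := hA.inner_vectorFlux_sub_pos hx
    rw [norm_neg, smul_neg, sub_neg_eq_add, sub_neg_eq_add, add_comm (p x), ← neg_neg
      (gradient u x + p x), inner_neg_right, neg_add, ← sub_eq_add_neg] at h
    linarith
  have hcoef : ∀ x, 0 ≤ 2 * max (d x) 0 * η x := fun x =>
    mul_nonneg (mul_nonneg zero_le_two (le_max_right _ _)) η.nonneg
  -- A continuous, nowhere positive integrand with nonnegative integral vanishes identically.
  have hzero : ∀ x, inner ℝ (X x) (gradient φ x) = 0 := fun x => by
    by_contra hx
    have h := Continuous.integral_pos_of_hasCompactSupport_nonneg_nonzero (μ := volume)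
      (hinner X hXc).1.neg (hinner X hXc).2.neg (fun y => ?_) (neg_ne_zero.2 hx)
    · simp only [Pi.neg_apply, integral_neg] at h
      linarith
    · rw [Pi.zero_apply, Pi.neg_apply, hφgrad, inner_smul_right, neg_nonneg]
      refine mul_nonpos_of_nonneg_of_nonpos (hcoef y) ?_
      by_cases hy : p y = -gradient u y
      · simp [hy]
      · exact (hJ y hy).le
  have hgφ : ∀ x, fderiv ℝ φ x = 0 := fun x => by
    have h : gradient φ x = 0 := by
      have := hzero x
      rw [hφgrad, inner_smul_right, mul_eq_zero] at this
      rw [hφgrad]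
      rcases this with h | h
      · rw [h, zero_smul]
      · by_cases hy : p x = -gradient u x
        · simp [hy]
        · exact absurd h (hJ x hy).ne
    rw [← toDual_gradient, h, map_zero]
  -- The comparison point lies at distance `R + 1`, where the cut-off `η` is zero.
  have hconst := is_const_of_fderiv_eq_zero (hφ1.differentiable one_ne_zero) hgφ 0
    (EuclideanSpace.single ⟨0, hN⟩ (R + 1))
  have h1 : φ (EuclideanSpace.single ⟨0, hN⟩ (R + 1)) = 0 := by
    simp only [hφ]
    rw [η.zero_of_le_dist, mul_zero]
    simpa using le_abs_self (R + 1)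
  have h2 : 0 < φ 0 := by
    have h3 : 0 < d 0 := by
      simp only [hd, norm_zero, hW0]
      linarith
    have h4 : η 0 = 1 := η.one_of_mem_closedBall (Metric.mem_closedBall_self hR.le)
    simp only [hφ, h4, max_eq_left h3.le]
    positivity
  linarith

theorem mainTheorem10 (N : ℕ) (hN : 2 ≤ N)
    (A : ℝ → ℝ) (hA : IsQuasilinearCoeff A)
    (hA_top : Tendsto (fun t : ℝ => t * A t) atTop atTop)
    (f : ℝ → ℝ) (hf : Continuous f)
    (hf_pos : ∀ t : ℝ, t < 0 → 0 < f t) (hf_anti : AntitoneOn f (Iio 0))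
    (hf_int : IntegrableOn (fun t : ℝ => 1 / energyH A (∫ s in t..(-1 : ℝ), f s)) (Iio (-1)))
    (u : EuclideanSpace ℝ (Fin N) → ℝ)
    (hu : IsWeakSupersolution A (fun x => f (u x)) u) :
    ∀ x, 0 ≤ u x := by
  intro x
  have h := (hu.comp_add_right x).nonneg_zero (one_le_two.trans hN) hA hA_top hf hf_pos hf_anti
    hf_int
  simpa using h
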